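/- Let $N$ qubits have collective spin components $J_\alpha=\tfrac12\sum_{k=1}^N\sigma_\alpha^{(k)}$ ($\alpha=x,y,z$). Let $\xi$ be stationary Gaussian white noise, centred, with correlator $\langle\xi(s)\xi(s')\rangle=\chi_0\omega_c\,\delta(s-s')$, where $\chi_0,\omega_c>0$. Consider the evolution on $[0,t]$, $t>0$, under $$H(s)=(b+\xi(s))\,J_z+\sum_{k=1}^{Q}\theta_k\,\delta(s-t_k)\,\mathcal O_k ,$$ with an arbitrary number $Q\ge 0$ of instantaneous pulses at arbitrary times $0<t_1<\dots<t_Q<t$, arbitrary angles $\theta_k\in\mathbb R$, and arbitrary collective Hermitian operators $\mathcal O_k$ (functions of $J_x,J_y,J_z$). Equivalently, with $t_0=0$, $t_{Q+1}=t$, $\Delta t_j=t_{j+1}-t_j$ and $\lambda_j=\int_{t_j}^{t_{j+1}}\xi(s)\,ds$, the output state for an input state $\rho_0$ is $\rho_b(t)=\langle U\rho_0U^\dagger\rangle$, where $\langle\cdot\rangle$ is the average over the noise and $$U=e^{-i(b\Delta t_Q+\lambda_Q)J_z}\,e^{-i\theta_Q\mathcal O_Q}\,e^{-i(b\Delta t_{Q-1}+\lambda_{Q-1})J_z}\cdots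 e^{-i\theta_1\mathcal O_1}\,e^{-i(b\Delta t_0+\lambda_0)J_z}.$$ Let $F_Q[\rho_b(t)]=2\sum_{p_i+p_j>0}|\langle i|\partial_b\rho_b(t)|j\rangle|^2/(p_i+p_j)$ be the quantum Fisher information with respect to $b$, where $\rho_b(t)=\sum_i p_i|i\rangle\langle i|$. For a total runtime $T>0$ put $F_Q^{\rm tot}=\tfrac{T}{t}F_Q[\rho_b(t)]$ and $\Delta\hat b^2_{\rm QCRB}=1/F_Q^{\rm tot}$ ($=\infty$ if $F_Q^{\rm tot}=0$). Then for every $N$, every input density matrix $\rho_0$, every $t$, $T$ and $b$, and every such pulse sequence, $\rho_b(t)$ is a density matrix, differentiable in $b$, and $$F_Q^{\rm tot}\le\frac{T}{\chi_0\omega_c},\qquad \Delta\hat b^2_{\rm QCRB}\ge\frac{\chi_0\omega_c}{T},$$ which is the $N$-independent bound that holds without control. Consequently no measurement does better: - for every observable $O$ with $\partial_b\langle O\rangle\ne0$, where $\langle O\rangle={\rm Tr}[\rho_b(t)O]$, the method-of-moments error satisfies $\dfrac{t\,(\langle O^2\rangle-\langle O\rangle^2)}{T\,(\partial_b\langle O\rangle)^2}\ge\dfrac{\chi_0\omega_c}{T}$;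 - if $T=\nu t$ with $\nu\in\mathbb N$, then for every measurement with finitely many outcomes (POVM) performed on each of $\nu$ independent shots, every estimator of $b$ from the $\nu$ outcomes that is unbiased in a neighbourhood of the true value $b$ has variance at least $\chi_0\omega_c/T$ there. -/

import Mathlib

open MeasureTheory ProbabilityTheory Topology Filter
open scoped Matrix ENNReal ComplexOrder

noncomputable section

namespace CollectiveDephasing

/-! ### N qubits and collective spin -/

/-- Operators on the Hilbert space of `N` qubits, as matrices in the product basis
(`0` is spin up, `1` is spin down). -/
abbrev Op (N : ℕ) : Type := Matrix (Fin N → Fin 2) (Fin N → Fin 2) ℂ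

/-- Pauli matrices. -/
def pauliX : Matrix (Fin 2) (Fin 2) ℂ := !![0, 1; 1, 0]
def pauliY : Matrix (Fin 2) (Fin 2) ℂ := !![0, -Complex.I; Complex.I, 0]
def pauliZ : Matrix (Fin 2) (Fin 2) ℂ := !![1, 0; 0, -1]

/-- The operator that acts as `A` on qubit `k` and as the identity on the others. -/
def onSite {N : ℕ} (k : Fin N) (A : Matrix (Fin 2) (Fin 2) ℂ) : Op N :=
  Matrix.of fun s s' => if ∀ l, l ≠ k → s l = s' l then A (s k) (s' k) else 0

/-- Collective spin components `J_α = (1/2) ∑ₖ σ_α^{(k)}`. -/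
def Jx (N : ℕ) : Op N := (1 / 2 : ℂ) • ∑ k : Fin N, onSite k pauliX
def Jy (N : ℕ) : Op N := (1 / 2 : ℂ) • ∑ k : Fin N, onSite k pauliY
def Jz (N : ℕ) : Op N := (1 / 2 : ℂ) • ∑ k : Fin N, onSite k pauliZ

/-- Collective operators: functions of the spin components, that is, elements of the (unital)
operator algebra generated by `J_x, J_y, J_z`. -/
def IsCollective {N : ℕ} (A : Op N) : Prop :=
  A ∈ Algebra.adjoin ℂ ({Jx N, Jy N, Jz N} : Set (Op N))

/-- Density matrices. -/
structure IsDensity {n : Type*} [Fintype n] (ρ : Matrix n n ℂ) : Prop where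
  posSemidef : ρ.PosSemidef
  trace_eq_one : ρ.trace = 1

/-! ### Noise -/

/-- `ξ` is Gaussian white noise of strength `c`: a centred Gaussian process indexed by
square-integrable test functions, `ξ f = ∫ f(s) ξ(s) ds`, with correlator
`⟨ξ(s) ξ(s')⟩ = c δ(s - s')`, that is, `⟨ξ f · ξ g⟩ = c ∫ f(s) g(s) ds`. -/
structure IsWhiteNoise {Ω : Type*} [MeasurableSpace Ω]
    (ξ : Lp ℝ 2 (volume : Measure ℝ) → Ω → ℝ) (c : ℝ) (P : Measure Ω) : Prop where
  gaussian : IsGaussianProcess ξ P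
  mean_zero : ∀ f, ∫ ω, ξ f ω ∂P = 0
  covariance : ∀ f g, cov[ξ f, ξ g; P] = c * inner ℝ f g

/-- The random phase `∫_s^u ξ(r) dr` accumulated between the times `s` and `u`. -/
def phase {Ω : Type*} (ξ : Lp ℝ 2 (volume : Measure ℝ) → Ω → ℝ) (s u : ℝ) : Ω → ℝ :=
  ξ (indicatorConstLp 2 (measurableSet_Ioc : MeasurableSet (Set.Ioc s u))
    measure_Ioc_lt_top.ne (1 : ℝ))

/-! ### Controlled dynamics -/

/-- A sequence of `Q` instantaneous collective pulses `exp(-i θₖ Oₖ)` applied at times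
`0 < t₁ < ⋯ < t_Q < t`; the times are `time 0 = 0`, `time 1 = t₁`, …, `time (Q + 1) = t`. -/
structure PulseSequence (N Q : ℕ) (t : ℝ) where
  time : Fin (Q + 2) → ℝ
  time_strictMono : StrictMono time
  time_zero : time 0 = 0
  time_last : time (Fin.last (Q + 1)) = t
  angle : Fin Q → ℝ
  op : Fin Q → Op N
  op_isHermitian : ∀ k, (op k).IsHermitian
  op_isCollective : ∀ k, IsCollective (op k)

/-- Evolution over one free segment with total phase `φ`: `exp(-i φ J_z)`. -/
def freeEvolution (N : ℕ) (φ : ℝ) : Op N := NormedSpace.exp ((-(Complex.I * φ)) • Jz N)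

/-- An instantaneous pulse `exp(-i θ O)`. -/
def pulse {N : ℕ} (θ : ℝ) (O : Op N) : Op N := NormedSpace.exp ((-(Complex.I * θ)) • O)

/-- Time-ordered propagator: free segments with phases `φ 0, …, φ Q`, with pulse `k` between the
segments `k` and `k + 1`; later factors stand on the left. -/
def propagator {N : ℕ} : (Q : ℕ) → (Fin Q → ℝ) → (Fin Q → Op N) → (Fin (Q + 1) → ℝ) → Op N
  | 0, _, _, φ => freeEvolution N (φ 0)
  | Q + 1, θ, O, φ =>
      freeEvolution N (φ (Fin.last (Q + 1))) * pulse (θ (Fin.last Q)) (O (Fin.last Q)) *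
        propagator Q (fun k => θ k.castSucc) (fun k => O k.castSucc) (fun j => φ j.castSucc)

/-- Total phase of segment `j` in a noise realization: `b Δtⱼ + λⱼ`. -/
def segmentPhase {Ω : Type*} {N Q : ℕ} {t : ℝ} (S : PulseSequence N Q t)
    (ξ : Lp ℝ 2 (volume : Measure ℝ) → Ω → ℝ) (b : ℝ) (ω : Ω) (j : Fin (Q + 1)) : ℝ :=
  b * (S.time j.succ - S.time j.castSucc) + phase ξ (S.time j.castSucc) (S.time j.succ) ω

/-- The stochastic propagator on `[0, t]` generated by
`(b + ξ(s)) J_z + ∑ₖ θₖ δ(s - tₖ) Oₖ`. -/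
def noisyPropagator {Ω : Type*} {N Q : ℕ} {t : ℝ} (S : PulseSequence N Q t)
    (ξ : Lp ℝ 2 (volume : Measure ℝ) → Ω → ℝ) (b : ℝ) (ω : Ω) : Op N :=
  propagator Q S.angle S.op (segmentPhase S ξ b ω)

/-- The noise-averaged output state `ρ_b(t)` for the input state `ρ₀`. -/
def outputState {Ω : Type*} [MeasurableSpace Ω] {N Q : ℕ} {t : ℝ} (P : Measure Ω)
    (ξ : Lp ℝ 2 (volume : Measure ℝ) → Ω → ℝ) (S : PulseSequence N Q t) (ρ₀ : Op N) (b : ℝ) :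
    Op N :=
  Matrix.of fun i j =>
    ∫ ω, (noisyPropagator S ξ b ω * ρ₀ * (noisyPropagator S ξ b ω)ᴴ) i j ∂P

/-! ### Quantum estimation -/

/-- Entrywise derivative `∂_b ρ_b` of a family of matrices. -/
def derivMatrix {n : Type*} (ρ : ℝ → Matrix n n ℂ) (b : ℝ) : Matrix n n ℂ :=
  Matrix.of fun i j => deriv (fun b' => ρ b' i j) b

open scoped Classical in
/-- Quantum Fisher information with respect to `b` of a family of density matrices,
`2 ∑_{pᵢ + pⱼ > 0} |⟨i| ∂_b ρ_b |j⟩|² / (pᵢ + pⱼ)`, for an eigenbasis `|i⟩` of `ρ_b` with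
eigenvalues `pᵢ` (set to `0` if `ρ_b` is not Hermitian). -/
def qfi {n : Type*} [Fintype n] (ρ : ℝ → Matrix n n ℂ) (b : ℝ) : ℝ :=
  if h : (ρ b).IsHermitian then
    2 * ∑ i, ∑ j, if 0 < h.eigenvalues i + h.eigenvalues j then
      ‖((h.eigenvectorUnitary : Matrix n n ℂ)ᴴ * derivMatrix ρ b *
        (h.eigenvectorUnitary : Matrix n n ℂ)) i j‖ ^ 2 /
        (h.eigenvalues i + h.eigenvalues j)
    else 0
  else 0

/-- Total quantum Fisher information of `T / t` shots of duration `t`. -/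
def totalQFI {n : Type*} [Fintype n] (T t : ℝ) (ρ : ℝ → Matrix n n ℂ) (b : ℝ) : ℝ :=
  T / t * qfi ρ b

/-- The quantum Cramér-Rao bound `1 / F_tot` on the variance (`∞` if `F_tot = 0`). -/
def qcrb {n : Type*} [Fintype n] (T t : ℝ) (ρ : ℝ → Matrix n n ℂ) (b : ℝ) : ℝ≥0∞ :=
  (ENNReal.ofReal (totalQFI T t ρ b))⁻¹

/-- Expectation value `Tr(ρ O)`. -/
def expect {n : Type*} [Fintype n] (ρ O : Matrix n n ℂ) : ℝ := (ρ * O).trace.re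

/-- Squared error of the method of moments for the observable `O` with `T / t` shots:
`t (⟨O²⟩ - ⟨O⟩²) / (T (∂_b ⟨O⟩)²)`. -/
def momentError {n : Type*} [Fintype n] (T t : ℝ) (ρ : ℝ → Matrix n n ℂ) (O : Matrix n n ℂ)
    (b : ℝ) : ℝ :=
  t * (expect (ρ b) (O * O) - expect (ρ b) O ^ 2) /
    (T * deriv (fun b' => expect (ρ b') O) b ^ 2)

/-- A measurement (positive operator-valued measure) with `m` outcomes. -/
structure IsPOVM {n : Type*} [Fintype n] [DecidableEq n] {m : ℕ} (E : Fin m → Matrix n n ℂ) :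
    Prop where
  posSemidef : ∀ x, (E x).PosSemidef
  sum_eq_one : ∑ x, E x = 1

/-- Expectation of a function `f` of the data when `E` is measured on each of `ν` independent
copies of `ρ`. -/
def dataExpect {n : Type*} [Fintype n] {m ν : ℕ} (ρ : Matrix n n ℂ) (E : Fin m → Matrix n n ℂ)
    (f : (Fin ν → Fin m) → ℝ) : ℝ :=
  ∑ x : Fin ν → Fin m, (∏ s, expect ρ (E (x s))) * f x

end CollectiveDephasing

end

open CollectiveDephasing

/-! The field enters only through the segment phases `φⱼ = b Δtⱼ + λⱼ`, where the `λⱼ` are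
independent centred Gaussians of variance `c Δtⱼ`, with `c = χ₀ ωc`. For fixed phases the output is
a density matrix that does not depend on `b`, so the experiment is a quantum post-processing of a
classical Gaussian shift family. That family has Fisher information `∑ⱼ Δtⱼ² / (c Δtⱼ) = t / c`, and
post-processing cannot increase it. Multiplying by `T / t` gives `T / c`, whatever `N` and the
pulses are.

Concretely, let `L = (∑ⱼ λⱼ) / c` be the score and `r` the state of one noise realization. Its
entries are trigonometric polynomials in the phases, because `J_z` is diagonal. For these, Gaussian
integration by parts gives `∂_b 𝔼[r] = 𝔼[L r]` (`IsPhaseNoise.hasDerivAt_integral_shift`), without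
any density. Cauchy-Schwarz in the noise and `Tr(r X)² ≤ Tr(r X²)` then yield `Tr(∂_b ρ X)² ≤ 𝔼[L²]
𝔼[Tr(r X)²] ≤ (t / c) Tr(ρ X²)` for every Hermitian `X` (`IsScoreModel.sq_expect_scoreAverage_le`).

All bounds come from this mechanism. Taking `X` to be the symmetric logarithmic derivative bounds
the quantum Fisher information (`qfi_le`), and a centred observable gives the method of moments. The
analogous inequality for POVM probabilities feeds a classical Cramér-Rao inequality for independent
shots (`one_le_mul_variance`). -/

/-! ### Gaussian characteristic functions and integration by parts -/

open Complex in
/-- Characteristic function of a centred Gaussian variable. -/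
lemma ProbabilityTheory.HasGaussianLaw.integral_cexp {Ω : Type*} [MeasurableSpace Ω]
    {P : Measure Ω} {X : Ω → ℝ} (hX : HasGaussianLaw X P) (h0 : ∫ ω, X ω ∂P = 0) :
    ∫ ω, cexp (I * X ω) ∂P = cexp (-(Var[X; P] : ℂ) / 2) := by
  have h := hX.charFun_map_eq 1
  rw [charFun_apply_real, integral_map hX.aemeasurable (by fun_prop)] at h
  simp only [ofReal_one, one_mul, RCLike.inner_apply, conj_trivial, mul_one] at h
  rw [h0] at h
  simp only [mul_comm I]
  rw [h]
  congr 1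
  push_cast
  ring

open Complex in
/-- Stein's identity for exponentials of jointly Gaussian centred variables. -/
lemma ProbabilityTheory.HasGaussianLaw.integral_mul_cexp {Ω : Type*} [MeasurableSpace Ω]
    {P : Measure Ω} {X W : Ω → ℝ} (h : HasGaussianLaw (fun ω => (X ω, W ω)) P)
    (hX0 : ∫ ω, X ω ∂P = 0) (hW0 : ∫ ω, W ω ∂P = 0) :
    ∫ ω, (W ω : ℂ) * cexp (I * X ω) ∂P =
      I * (cov[X, W; P] : ℂ) * ∫ ω, cexp (I * X ω) ∂P := by
  have := h.isProbabilityMeasure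
  have hX := h.fst
  have hW := h.snd
  have hXm := hX.aemeasurable
  have hWm := hW.aemeasurable
  -- The identity results from computing the derivative at `u = 0` of `𝔼 exp(i (X + u W))` twice:
  -- from the Gaussian closed form, whose exponent is quadratic in `u`, and under the integral sign,
  -- with dominating function `|W|`.
  have hclosed : ∀ u : ℝ, ∫ ω, cexp (I * ((X ω + u * W ω : ℝ) : ℂ)) ∂P =
      cexp (-((Var[X; P] + 2 * (u * cov[X, W; P]) + u ^ 2 * Var[W; P] : ℝ) : ℂ) / 2) := by
    intro u
    have hg : HasGaussianLaw (fun ω => X ω + u * W ω) P :=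
      h.map_fun (ContinuousLinearMap.fst ℝ ℝ ℝ + u • ContinuousLinearMap.snd ℝ ℝ ℝ)
    have h0 : ∫ ω, X ω + u * W ω ∂P = 0 := by
      rw [integral_add hX.integrable (hW.integrable.const_mul u), integral_const_mul, hX0, hW0]
      simp
    rw [hg.integral_cexp h0]
    congr 4
    have hv : Var[X + fun ω => u * W ω; P] = _ :=
      variance_add hX.memLp_two (hW.memLp_two.const_mul u)
    rw [covariance_const_mul_right, variance_const_mul] at hv
    exact hv
  have hd : HasDerivAt (fun u : ℝ => ∫ ω, cexp (I * ((X ω + u * W ω : ℝ) : ℂ)) ∂P)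
      (∫ ω, cexp (I * ((X ω + (0 : ℝ) * W ω : ℝ) : ℂ)) * (I * (W ω : ℂ)) ∂P) 0 := by
    refine (hasDerivAt_integral_of_dominated_loc_of_deriv_le (bound := fun ω => |W ω|)
      (F' := fun u ω => cexp (I * ((X ω + u * W ω : ℝ) : ℂ)) * (I * (W ω : ℂ)))
      (s := Set.univ) Filter.univ_mem ?_ ?_ ?_ ?_ ?_ ?_).2
    · filter_upwards with u
      exact (by fun_prop : AEMeasurable _ P).aestronglyMeasurable
    · refine Integrable.of_bound
        (by fun_prop : AEMeasurable _ P).aestronglyMeasurable 1 (Eventually.of_forall fun ω => ?_)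
      rw [mul_comm, norm_exp_ofReal_mul_I]
    · exact (by fun_prop : AEMeasurable _ P).aestronglyMeasurable
    · refine Eventually.of_forall fun ω u _ => ?_
      rw [norm_mul, mul_comm I ((X ω + u * W ω : ℝ) : ℂ), norm_exp_ofReal_mul_I]
      simp
    · exact hW.integrable.abs
    · refine Eventually.of_forall fun ω u _ => ?_
      have h1 : HasDerivAt (fun u : ℝ => X ω + u * W ω) (W ω) u := by
        simpa using ((hasDerivAt_id u).mul_const (W ω)).const_add (X ω)
      exact (h1.ofReal_comp.const_mul I).cexp
  have hd' : HasDerivAt (fun u : ℝ =>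
      cexp (-((Var[X; P] + 2 * (u * cov[X, W; P]) + u ^ 2 * Var[W; P] : ℝ) : ℂ) / 2))
      (cexp (-(Var[X; P] : ℂ) / 2) * (-(cov[X, W; P] : ℂ))) 0 := by
    have h1 : HasDerivAt (fun u : ℝ =>
        Var[X; P] + 2 * (u * cov[X, W; P]) + u ^ 2 * Var[W; P]) (2 * cov[X, W; P]) 0 := by
      have h2 := (hasDerivAt_id' (0 : ℝ)).mul_const (cov[X, W; P])
      have h3 := (hasDerivAt_pow 2 (0 : ℝ)).mul_const (Var[W; P])
      exact (((h2.const_mul 2).const_add (Var[X; P])).fun_add h3).congr_deriv (by simp)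
    have h4 : HasDerivAt (fun u : ℝ =>
        -((Var[X; P] + 2 * (u * cov[X, W; P]) + u ^ 2 * Var[W; P] : ℝ) : ℂ) / 2)
        (-((2 * cov[X, W; P] : ℝ) : ℂ) / 2) 0 := h1.ofReal_comp.fun_neg.div_const 2
    refine h4.cexp.congr_deriv ?_
    push_cast
    simp only [zero_mul, mul_zero, add_zero, ne_eq, OfNat.ofNat_ne_zero, not_false_eq_true,
      zero_pow]
    ring
  have key := hd.unique (by simpa only [hclosed] using hd')
  rw [hX.integral_cexp hX0]
  simp only [zero_mul, add_zero] at key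
  have h2 : ∫ ω, cexp (I * (X ω : ℂ)) * (I * (W ω : ℂ)) ∂P =
      I * ∫ ω, (W ω : ℂ) * cexp (I * X ω) ∂P := by
    rw [← integral_const_mul]
    congr 1; ext ω; ring
  rw [h2] at key
  calc _ = -(I * (I * ∫ ω, (W ω : ℂ) * cexp (I * X ω) ∂P)) := by
        rw [← mul_assoc, I_mul_I]; ring
    _ = _ := by rw [key]; ring

namespace CollectiveDephasing

open Complex

/-! ### Trigonometric polynomials -/

/-- The plane wave `φ ↦ exp(i ∑ⱼ kⱼ φⱼ)`. -/
noncomputable def planeWave {n : ℕ} (k : Fin n → ℝ) (φ : Fin n → ℝ) : ℂ :=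
  cexp (I * ((∑ j, k j * φ j : ℝ) : ℂ))

lemma planeWave_mul {n : ℕ} (k l : Fin n → ℝ) :
    planeWave k * planeWave l = planeWave (k + l) := by
  ext φ
  simp only [planeWave, Pi.mul_apply, Pi.add_apply, ← Complex.exp_add]
  congr 1
  rw [← mul_add, ← ofReal_add, ← Finset.sum_add_distrib]
  simp only [add_mul]

/-- Trigonometric polynomials in `n` real variables, with arbitrary real frequencies. -/
def trigPoly (n : ℕ) : Subalgebra ℂ ((Fin n → ℝ) → ℂ) :=
  (Submodule.span ℂ (Set.range (planeWave (n := n)))).toSubalgebra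
    (Submodule.subset_span ⟨0, by ext φ; simp [planeWave]⟩) (by
      intro f g hf hg
      have h := Submodule.mul_mem_mul hf hg
      rw [Submodule.span_mul_span] at h
      refine Submodule.span_mono ?_ h
      rintro _ ⟨_, ⟨k, rfl⟩, _, ⟨l, rfl⟩, rfl⟩
      exact ⟨k + l, (planeWave_mul k l).symm⟩)

lemma planeWave_mem_trigPoly {n : ℕ} (k : Fin n → ℝ) : planeWave k ∈ trigPoly n :=
  Submodule.subset_span ⟨k, rfl⟩

lemma trigPoly_induction {n : ℕ} {p : ((Fin n → ℝ) → ℂ) → Prop}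
    (wave : ∀ k, p (planeWave k)) (add : ∀ f g, p f → p g → p (f + g))
    (smul : ∀ (a : ℂ) f, p f → p (a • f)) {f : (Fin n → ℝ) → ℂ} (hf : f ∈ trigPoly n) : p f := by
  refine Submodule.span_induction (p := fun f _ => p f) ?_ ?_ (fun f g _ _ => add f g)
    (fun a f _ => smul a f) hf
  · rintro _ ⟨k, rfl⟩
    exact wave k
  -- The zero function is `0` times a plane wave, so the induction principle needs no separate zero
  -- case.
  · simpa using smul 0 _ (wave 0)

lemma star_mem_trigPoly {n : ℕ} {f : (Fin n → ℝ) → ℂ} (hf : f ∈ trigPoly n) :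
    star f ∈ trigPoly n := by
  refine trigPoly_induction (p := fun f => star f ∈ trigPoly n) ?_ ?_ ?_ hf
  · intro k
    convert planeWave_mem_trigPoly (-k) using 1
    ext φ
    simp only [planeWave, Pi.star_apply, RCLike.star_def, ← Complex.exp_conj]
    congr 1
    simp
  · intro f g hf hg
    rw [star_add]
    exact add_mem hf hg
  · intro a f hf
    rw [star_smul]
    exact (trigPoly n).smul_mem hf _

lemma continuous_of_mem_trigPoly {n : ℕ} {f : (Fin n → ℝ) → ℂ} (hf : f ∈ trigPoly n) :
    Continuous f := by
  refine trigPoly_induction (p := Continuous) ?_ ?_ ?_ hf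
  · intro k
    unfold planeWave
    fun_prop
  · intro f g hf hg
    exact hf.add hg
  · intro a f hf
    exact hf.const_smul a

lemma exists_norm_le_of_mem_trigPoly {n : ℕ} {f : (Fin n → ℝ) → ℂ} (hf : f ∈ trigPoly n) :
    ∃ C, ∀ φ, ‖f φ‖ ≤ C := by
  refine trigPoly_induction (p := fun f => ∃ C, ∀ φ, ‖f φ‖ ≤ C) ?_ ?_ ?_ hf
  · intro k
    refine ⟨1, fun φ => ?_⟩
    rw [planeWave, mul_comm, norm_exp_ofReal_mul_I]
  · rintro f g ⟨C, hC⟩ ⟨D, hD⟩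
    exact ⟨C + D, fun φ => (norm_add_le _ _).trans (add_le_add (hC φ) (hD φ))⟩
  · rintro a f ⟨C, hC⟩
    refine ⟨‖a‖ * C, fun φ => ?_⟩
    rw [Pi.smul_apply, norm_smul]
    exact mul_le_mul_of_nonneg_left (hC φ) (norm_nonneg _)

/-! ### Gaussian phases and their score -/

/-- Independent centred Gaussian phases `lam j` of variance `c * Δ j`. -/
structure IsPhaseNoise {Ω : Type*} [MeasurableSpace Ω] {n : ℕ} (lam : Fin n → Ω → ℝ) (c : ℝ)
    (Δ : Fin n → ℝ) (P : Measure Ω) : Prop where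
  gaussian : HasGaussianLaw (fun ω j => lam j ω) P
  mean_zero : ∀ j, ∫ ω, lam j ω ∂P = 0
  covariance : ∀ i j, cov[lam i, lam j; P] = if i = j then c * Δ i else 0

namespace IsPhaseNoise

/-- The score of the shift family `b ↦ b Δ + lam`. -/
noncomputable def score {Ω : Type*} {n : ℕ} (lam : Fin n → Ω → ℝ) (c : ℝ) (ω : Ω) : ℝ := (∑ j, lam j ω) / c

lemma score_eq {Ω : Type*} {n : ℕ} (lam : Fin n → Ω → ℝ) (c : ℝ) :
    score lam c = fun ω => ∑ j, (fun _ => c⁻¹ : Fin n → ℝ) j * lam j ω := by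
  ext ω
  rw [score, div_eq_inv_mul, Finset.mul_sum]

variable {Ω : Type*} [MeasurableSpace Ω] {n : ℕ} {lam : Fin n → Ω → ℝ} {c : ℝ}
  {Δ : Fin n → ℝ} {P : Measure Ω}

lemma memLp_two (h : IsPhaseNoise lam c Δ P) (j : Fin n) : MemLp (lam j) 2 P :=
  (h.gaussian.eval j).memLp_two

lemma integral_weighted_sum (h : IsPhaseNoise lam c Δ P) (k : Fin n → ℝ) :
    ∫ ω, ∑ j, k j * lam j ω ∂P = 0 := by
  rw [integral_finsetSum _ fun j _ => ((h.gaussian.eval j).integrable.const_mul (k j))]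
  simp [integral_const_mul, h.mean_zero]

lemma covariance_weighted_sum (h : IsPhaseNoise lam c Δ P) (k l : Fin n → ℝ) :
    cov[fun ω => ∑ j, k j * lam j ω, fun ω => ∑ j, l j * lam j ω; P] =
      c * ∑ j, k j * l j * Δ j := by
  have := h.gaussian.isProbabilityMeasure
  rw [covariance_fun_sum_fun_sum (fun j => (h.memLp_two j).const_mul (k j))
    (fun j => (h.memLp_two j).const_mul (l j))]
  simp only [covariance_const_mul_left, covariance_const_mul_right, h.covariance, mul_ite,
    mul_zero, Finset.sum_ite_eq, Finset.mem_univ, if_true, Finset.mul_sum]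
  exact Finset.sum_congr rfl fun j _ => by ring

lemma hasGaussianLaw_weighted_sums (h : IsPhaseNoise lam c Δ P) (k l : Fin n → ℝ) :
    HasGaussianLaw (fun ω => (∑ j, k j * lam j ω, ∑ j, l j * lam j ω)) P := by
  have := h.gaussian.map_fun
    ((∑ j, k j • ContinuousLinearMap.proj (R := ℝ) (φ := fun _ : Fin n => ℝ) j).prod
      (∑ j, l j • ContinuousLinearMap.proj (R := ℝ) (φ := fun _ : Fin n => ℝ) j))
  simpa using this

lemma memLp_score (h : IsPhaseNoise lam c Δ P) : MemLp (score lam c) 2 P := by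
  rw [score_eq]
  exact (h.hasGaussianLaw_weighted_sums _ 0).fst.memLp_two

lemma integral_score (h : IsPhaseNoise lam c Δ P) : ∫ ω, score lam c ω ∂P = 0 := by
  rw [score_eq]
  exact h.integral_weighted_sum _

/-- The Fisher information of the shift family: `∑ lam j` has variance `c ∑ Δ j`, and the score
divides it by `c`. -/
lemma integral_score_sq (h : IsPhaseNoise lam c Δ P) (hc : c ≠ 0) :
    ∫ ω, score lam c ω ^ 2 ∂P = (∑ j, Δ j) / c := by
  have := h.gaussian.isProbabilityMeasure
  have h1 := variance_of_integral_eq_zero h.memLp_score.1.aemeasurable h.integral_score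
  rw [← h1, ← covariance_self h.memLp_score.1.aemeasurable, score_eq,
    h.covariance_weighted_sum, ← Finset.mul_sum]
  field_simp

lemma integrable_shift (h : IsPhaseNoise lam c Δ P) {f : (Fin n → ℝ) → ℂ} (hf : f ∈ trigPoly n)
    (b : ℝ) : Integrable (fun ω => f fun j => b * Δ j + lam j ω) P := by
  have := h.gaussian.isProbabilityMeasure
  obtain ⟨C, hC⟩ := exists_norm_le_of_mem_trigPoly hf
  have hm : AEMeasurable (fun ω j => lam j ω) P := h.gaussian.aemeasurable
  have hm' : AEMeasurable (fun ω j => b * Δ j + lam j ω) P := by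
    rw [aemeasurable_pi_iff] at hm ⊢
    exact fun j => (hm j).const_add _
  exact Integrable.of_bound
    ((continuous_of_mem_trigPoly hf).measurable.comp_aemeasurable hm').aestronglyMeasurable C
    (Eventually.of_forall fun ω => hC _)

lemma integrable_score_mul_shift (h : IsPhaseNoise lam c Δ P) {f : (Fin n → ℝ) → ℂ}
    (hf : f ∈ trigPoly n) (b : ℝ) :
    Integrable (fun ω => (score lam c ω : ℂ) * f fun j => b * Δ j + lam j ω) P := by
  have := h.gaussian.isProbabilityMeasure
  obtain ⟨C, hC⟩ := exists_norm_le_of_mem_trigPoly hf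
  exact (h.memLp_score.integrable one_le_two).ofReal.mul_bdd (c := C)
    (h.integrable_shift hf b).1 (Eventually.of_forall fun ω => hC _)

/-- By linearity it suffices to treat a plane wave with frequencies `k`. There `b` enters only
through the factor `exp(i b κ)` with `κ = ∑ kⱼ Δⱼ`, so differentiation multiplies by `i κ`. By
Stein's identity the score multiplies the mean by `i cov(X, score)`, and this covariance is also
`κ`. -/
lemma hasDerivAt_integral_shift (h : IsPhaseNoise lam c Δ P) (hc : c ≠ 0)
    {f : (Fin n → ℝ) → ℂ} (hf : f ∈ trigPoly n) (b : ℝ) :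
    HasDerivAt (fun b : ℝ => ∫ ω, f (fun j => b * Δ j + lam j ω) ∂P)
      (∫ ω, (score lam c ω : ℂ) * f (fun j => b * Δ j + lam j ω) ∂P) b := by
  -- Membership is carried through the induction because the additive step needs integrability to
  -- split the integrals.
  have main : f ∈ trigPoly n ∧ HasDerivAt (fun b : ℝ => ∫ ω, f (fun j => b * Δ j + lam j ω) ∂P)
      (∫ ω, (score lam c ω : ℂ) * f (fun j => b * Δ j + lam j ω) ∂P) b := by
    refine trigPoly_induction (p := fun f => f ∈ trigPoly n ∧
      HasDerivAt (fun b : ℝ => ∫ ω, f (fun j => b * Δ j + lam j ω) ∂P)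
      (∫ ω, (score lam c ω : ℂ) * f (fun j => b * Δ j + lam j ω) ∂P) b) ?_ ?_ ?_ hf
    · intro k
      refine ⟨planeWave_mem_trigPoly k, ?_⟩
      set X : Ω → ℝ := fun ω => ∑ j, k j * lam j ω with hX
      set κ : ℝ := ∑ j, k j * Δ j with hκ
      have hsplit : ∀ (b : ℝ) ω, planeWave k (fun j => b * Δ j + lam j ω) =
          cexp (I * ((b * κ : ℝ) : ℂ)) * cexp (I * (X ω : ℂ)) := by
        intro b ω
        rw [planeWave, ← Complex.exp_add, ← mul_add, ← ofReal_add]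
        congr 3
        rw [hκ, Finset.mul_sum, hX, ← Finset.sum_add_distrib]
        exact Finset.sum_congr rfl fun j _ => by ring
      have hstein : ∫ ω, (score lam c ω : ℂ) * cexp (I * X ω) ∂P =
          I * (κ : ℂ) * ∫ ω, cexp (I * X ω) ∂P := by
        have hg := h.hasGaussianLaw_weighted_sums k fun _ => c⁻¹
        rw [score_eq, hg.integral_mul_cexp (h.integral_weighted_sum _)
          (h.integral_weighted_sum _), h.covariance_weighted_sum]
        congr 3
        rw [hκ, Finset.mul_sum]
        refine Finset.sum_congr rfl fun j _ => ?_
        field_simp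
      simp only [hsplit]
      have e1 : ∀ ω, (score lam c ω : ℂ) * (cexp (I * ((b * κ : ℝ) : ℂ)) * cexp (I * (X ω : ℂ)))
          = cexp (I * ((b * κ : ℝ) : ℂ)) * ((score lam c ω : ℂ) * cexp (I * (X ω : ℂ))) :=
        fun ω => by ring
      simp only [e1, integral_const_mul, hstein]
      have h1 : HasDerivAt (fun b : ℝ => b * κ) κ b := by
        simpa using (hasDerivAt_id b).mul_const κ
      exact ((h1.ofReal_comp.const_mul I).cexp.mul_const (∫ ω, cexp (I * X ω) ∂P)).congr_deriv
        (by ring)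
    · rintro f g ⟨hf, hf'⟩ ⟨hg, hg'⟩
      refine ⟨add_mem hf hg, ?_⟩
      simp only [Pi.add_apply, mul_add]
      rw [integral_add (h.integrable_score_mul_shift hf b) (h.integrable_score_mul_shift hg b)]
      have e : (fun b : ℝ => ∫ ω, (f (fun j => b * Δ j + lam j ω) +
          g (fun j => b * Δ j + lam j ω)) ∂P) = fun b : ℝ =>
          ∫ ω, f (fun j => b * Δ j + lam j ω) ∂P + ∫ ω, g (fun j => b * Δ j + lam j ω) ∂P := by
        ext b
        exact integral_add (h.integrable_shift hf b) (h.integrable_shift hg b)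
      rw [e]
      exact hf'.add hg'
    · rintro a f ⟨hf, hf'⟩
      refine ⟨(trigPoly n).smul_mem hf a, ?_⟩
      simp only [Pi.smul_apply, smul_eq_mul, mul_left_comm _ a, integral_const_mul]
      exact hf'.const_mul a
  exact main.2

end IsPhaseNoise

/-! ### Propagators: unitarity and dependence on the phases -/

lemma onSite_pauliZ {N : ℕ} (k : Fin N) :
    onSite k pauliZ = Matrix.diagonal fun s => ((if s k = 0 then 1 else -1 : ℝ) : ℂ) := by
  ext s s'
  simp only [onSite, Matrix.of_apply, Matrix.diagonal_apply]
  by_cases h : s = s'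
  · subst h
    have : s k = 0 ∨ s k = 1 := by omega
    rcases this with h | h <;> simp [h, pauliZ]
  · rw [if_neg h]
    split_ifs with h'
    · have hk : s k ≠ s' k := fun hk => h (funext fun l => by
        by_cases hl : l = k
        · rw [hl, hk]
        · exact h' l hl)
      have : (s k = 0 ∧ s' k = 1) ∨ (s k = 1 ∧ s' k = 0) := by omega
      rcases this with ⟨h1, h2⟩ | ⟨h1, h2⟩ <;> simp [h1, h2, pauliZ]
    · rfl

/-- Eigenvalue of `J_z` on a product basis state. -/
noncomputable def magnetization {N : ℕ} (s : Fin N → Fin 2) : ℝ :=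
  (1 / 2) * ∑ k, (if s k = 0 then 1 else -1 : ℝ)

lemma Jz_eq_diagonal (N : ℕ) :
    Jz N = Matrix.diagonal fun s => ((magnetization s : ℝ) : ℂ) := by
  ext s s'
  simp only [Jz, onSite_pauliZ, Matrix.smul_apply, Matrix.sum_apply, Matrix.diagonal_apply,
    magnetization]
  split_ifs with h <;> simp

lemma freeEvolution_eq_diagonal (N : ℕ) (φ : ℝ) :
    freeEvolution N φ = Matrix.diagonal fun s => cexp (I * ((-magnetization s * φ : ℝ) : ℂ)) := by
  rw [freeEvolution, Jz_eq_diagonal, ← Matrix.diagonal_smul, Matrix.exp_diagonal]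
  congr 1
  ext s
  rw [Pi.coe_exp, ← Complex.exp_eq_exp_ℂ]
  simp only [Pi.smul_apply, smul_eq_mul]
  congr 1
  push_cast
  ring

lemma conjTranspose_mul_self_exp {n : Type*} [Fintype n] [DecidableEq n] (θ : ℝ)
    {A : Matrix n n ℂ} (hA : A.IsHermitian) :
    (NormedSpace.exp ((-(I * θ)) • A))ᴴ * NormedSpace.exp ((-(I * θ)) • A) = 1 := by
  have h : ((-(I * θ)) • A)ᴴ = -((-(I * θ)) • A) := by
    rw [Matrix.conjTranspose_smul, hA.eq, ← neg_smul]
    simp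
  rw [← Matrix.exp_conjTranspose, h, Matrix.exp_neg]
  exact Matrix.nonsing_inv_mul _ ((Matrix.isUnit_iff_isUnit_det _).1 (Matrix.isUnit_exp _))

lemma Jz_isHermitian (N : ℕ) : (Jz N).IsHermitian := by
  rw [Jz_eq_diagonal]
  exact Matrix.isHermitian_diagonal_of_self_adjoint _ (by ext s; simp)

lemma conjTranspose_mul_self_mul {n : Type*} [Fintype n] [DecidableEq n] {A B : Matrix n n ℂ}
    (hA : Aᴴ * A = 1) (hB : Bᴴ * B = 1) : (A * B)ᴴ * (A * B) = 1 := by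
  rw [Matrix.conjTranspose_mul, Matrix.mul_assoc, ← Matrix.mul_assoc Aᴴ, hA, Matrix.one_mul, hB]

lemma conjTranspose_mul_self_propagator {N : ℕ} : ∀ (Q : ℕ) (θ : Fin Q → ℝ) (O : Fin Q → Op N)
    (_ : ∀ k, (O k).IsHermitian) (φ : Fin (Q + 1) → ℝ),
    (propagator Q θ O φ)ᴴ * propagator Q θ O φ = 1
  | 0, _, _, _, _ => conjTranspose_mul_self_exp _ (Jz_isHermitian N)
  | Q + 1, _, _, hO, _ =>
      conjTranspose_mul_self_mul
        (conjTranspose_mul_self_mul (conjTranspose_mul_self_exp _ (Jz_isHermitian N))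
          (conjTranspose_mul_self_exp _ (hO _)))
        (conjTranspose_mul_self_propagator Q _ _ (fun k => hO k.castSucc) _)

lemma IsDensity.conj {n : Type*} [Fintype n] [DecidableEq n] {ρ U : Matrix n n ℂ}
    (hρ : IsDensity ρ) (hU : Uᴴ * U = 1) : IsDensity (U * ρ * Uᴴ) where
  posSemidef := hρ.posSemidef.mul_mul_conjTranspose_same U
  trace_eq_one := by rw [Matrix.trace_mul_cycle, hU, Matrix.one_mul, hρ.trace_eq_one]

/-- All entries of the matrix-valued function are trigonometric polynomials. -/
def IsTrigPoly {n : Type*} {m : ℕ} (A : (Fin m → ℝ) → Matrix n n ℂ) : Prop :=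
  ∀ i j, (fun φ => A φ i j) ∈ trigPoly m

namespace IsTrigPoly

variable {n : Type*} {m : ℕ} {A B : (Fin m → ℝ) → Matrix n n ℂ}

lemma const (C : Matrix n n ℂ) : IsTrigPoly fun _ : Fin m → ℝ => C :=
  fun i j => (trigPoly m).algebraMap_mem (C i j)

lemma mul [Fintype n] (hA : IsTrigPoly A) (hB : IsTrigPoly B) :
    IsTrigPoly fun φ => A φ * B φ := by
  intro i j
  have : (fun φ => (A φ * B φ) i j) = ∑ k, (fun φ => A φ i k) * fun φ => B φ k j := by
    ext φ
    simp [Matrix.mul_apply]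
  rw [this]
  exact sum_mem fun k _ => mul_mem (hA i k) (hB k j)

lemma conjTranspose (hA : IsTrigPoly A) : IsTrigPoly fun φ => (A φ)ᴴ :=
  fun i j => star_mem_trigPoly (hA j i)

lemma freeEvolution (N : ℕ) (j : Fin m) :
    IsTrigPoly fun φ => freeEvolution N (φ j) := by
  intro s s'
  simp only [freeEvolution_eq_diagonal, Matrix.diagonal_apply]
  split_ifs with h
  · convert planeWave_mem_trigPoly (Pi.single j (-magnetization s)) using 1
    ext φ
    simp [planeWave, Pi.single_apply]
  · exact zero_mem _

/-- The reindexing `g` keeps the number `m` of variables fixed while the recursion on `Q` drops the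
last segment. -/
lemma propagator {N : ℕ} : ∀ (Q : ℕ) (θ : Fin Q → ℝ) (O : Fin Q → Op N)
    (g : Fin (Q + 1) → Fin m),
    IsTrigPoly fun φ : Fin m → ℝ => propagator Q θ O fun j => φ (g j)
  | 0, _, _, g => freeEvolution N (g 0)
  | Q + 1, _, _, g =>
      ((freeEvolution N (g (Fin.last (Q + 1)))).mul (const _)).mul
        (propagator Q _ _ fun j => g j.castSucc)

end IsTrigPoly

/-- Output state for fixed segment phases. -/
noncomputable def conditionalState {N Q : ℕ} (θ : Fin Q → ℝ) (O : Fin Q → Op N) (ρ₀ : Op N)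
    (φ : Fin (Q + 1) → ℝ) : Op N :=
  propagator Q θ O φ * ρ₀ * (propagator Q θ O φ)ᴴ

lemma isTrigPoly_conditionalState {N Q : ℕ} (θ : Fin Q → ℝ) (O : Fin Q → Op N) (ρ₀ : Op N) :
    IsTrigPoly (conditionalState θ O ρ₀) :=
  ((IsTrigPoly.propagator Q θ O id).mul (.const ρ₀)).mul
    (IsTrigPoly.propagator Q θ O id).conjTranspose

lemma isDensity_conditionalState {N Q : ℕ} (θ : Fin Q → ℝ) {O : Fin Q → Op N}
    (hO : ∀ k, (O k).IsHermitian) {ρ₀ : Op N} (hρ₀ : IsDensity ρ₀) (φ : Fin (Q + 1) → ℝ) :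
    IsDensity (conditionalState θ O ρ₀ φ) :=
  hρ₀.conj (conjTranspose_mul_self_propagator Q θ O hO φ)

/-! ### From white noise to independent segment phases -/

/-- Indicators of successive half-open intervals are orthogonal in `L²`, with squared norms equal to
the interval lengths. -/
lemma IsWhiteNoise.isPhaseNoise {Ω : Type*} [MeasurableSpace Ω] {P : Measure Ω}
    {ξ : Lp ℝ 2 (volume : Measure ℝ) → Ω → ℝ} {c : ℝ} (hξ : IsWhiteNoise ξ c P)
    {n : ℕ} {τ : Fin (n + 1) → ℝ} (hτ : Monotone τ) :
    IsPhaseNoise (fun j : Fin n => phase ξ (τ j.castSucc) (τ j.succ)) c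
      (fun j => τ j.succ - τ j.castSucc) P where
  gaussian := by
    have h : IsGaussianProcess (fun j : Fin n => phase ξ (τ j.castSucc) (τ j.succ)) P :=
      hξ.gaussian.comp_right fun j : Fin n => indicatorConstLp 2
        (measurableSet_Ioc : MeasurableSet (Set.Ioc (τ j.castSucc) (τ j.succ)))
        measure_Ioc_lt_top.ne (1 : ℝ)
    -- Finite-dimensional laws are indexed by the subtype of `Finset.univ`; a linear reindexing
    -- carries the law to `Fin n`.
    exact (h.hasGaussianLaw Finset.univ).map_fun
      (ContinuousLinearMap.pi fun j : Fin n =>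
        ContinuousLinearMap.proj (R := ℝ) (φ := fun _ : (Finset.univ : Finset (Fin n)) => ℝ)
          ⟨j, Finset.mem_univ j⟩)
  mean_zero j := hξ.mean_zero _
  covariance i j := by
    rw [phase, phase, hξ.covariance, L2.real_inner_indicatorConstLp_one_indicatorConstLp_one
      measurableSet_Ioc measurableSet_Ioc measure_Ioc_lt_top.ne measure_Ioc_lt_top.ne]
    split_ifs with h
    · subst h
      rw [Set.inter_self, Real.volume_real_Ioc_of_le (hτ (Fin.castSucc_le_succ i))]
    · have hd : Set.Ioc (τ i.castSucc) (τ i.succ) ∩ Set.Ioc (τ j.castSucc) (τ j.succ) = ∅ := by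
        rw [Set.Ioc_inter_Ioc, Set.Ioc_eq_empty_iff, not_lt]
        rcases lt_or_gt_of_ne h with h | h
        · exact (min_le_left _ _).trans ((hτ (by simpa [Fin.le_def] using h)).trans
            (le_max_right _ _))
        · exact (min_le_right _ _).trans ((hτ (by simpa [Fin.le_def] using h)).trans
            (le_max_left _ _))
      rw [hd]
      simp

/-! ### Expectation values and the quantum Fisher information -/

section Expectation

variable {n : Type*} [Fintype n]

lemma expect_eq_sum (ρ X : Matrix n n ℂ) :
    expect ρ X = ∑ i, ∑ j, (ρ i j * X j i).re := by
  simp [expect, Matrix.trace, Matrix.mul_apply]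

lemma expect_add (ρ X Y : Matrix n n ℂ) : expect ρ (X + Y) = expect ρ X + expect ρ Y := by
  simp [expect, Matrix.mul_add]

lemma expect_sub (ρ X Y : Matrix n n ℂ) : expect ρ (X - Y) = expect ρ X - expect ρ Y := by
  simp [expect, Matrix.mul_sub]

lemma expect_smul (ρ X : Matrix n n ℂ) (a : ℝ) : expect ρ ((a : ℂ) • X) = a * expect ρ X := by
  simp [expect]

lemma smul_expect (ρ X : Matrix n n ℂ) (a : ℝ) : expect ((a : ℂ) • ρ) X = a * expect ρ X := by
  simp [expect]

lemma expect_sum {ι : Type*} (s : Finset ι) (ρ : Matrix n n ℂ) (X : ι → Matrix n n ℂ) :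
    expect ρ (∑ x ∈ s, X x) = ∑ x ∈ s, expect ρ (X x) := by
  simp [expect, Matrix.mul_sum, Matrix.trace_sum]

lemma expect_sum_povm [DecidableEq n] {m : ℕ} {E : Fin m → Matrix n n ℂ} (hE : IsPOVM E)
    (ρ : Matrix n n ℂ) : ∑ x, expect ρ (E x) = expect ρ 1 := by
  rw [← expect_sum, hE.sum_eq_one]

lemma IsDensity.expect_one [DecidableEq n] {ρ : Matrix n n ℂ} (hρ : IsDensity ρ) :
    expect ρ 1 = 1 := by
  simp [expect, hρ.trace_eq_one]

lemma expect_conjTranspose_mul_nonneg {ρ : Matrix n n ℂ} (hρ : ρ.PosSemidef)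
    (X : Matrix n n ℂ) : 0 ≤ expect ρ (Xᴴ * X) := by
  have h := (hρ.mul_mul_conjTranspose_same X).trace_nonneg
  rw [Matrix.trace_mul_cycle, Matrix.trace_mul_comm] at h
  exact (Complex.nonneg_iff.1 h).1

lemma expect_vecMulVec (ρ : Matrix n n ℂ) (v : n → ℂ) :
    expect ρ (Matrix.vecMulVec v (star v)) = (star v ⬝ᵥ ρ *ᵥ v).re := by
  rw [expect, Matrix.mul_vecMulVec, Matrix.trace_vecMulVec, dotProduct_comm]

lemma expect_nonneg {ρ X : Matrix n n ℂ} (hρ : ρ.PosSemidef) (hX : X.PosSemidef) :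
    0 ≤ expect ρ X := by
  obtain ⟨m, v, rfl⟩ := Matrix.posSemidef_iff_eq_sum_vecMulVec.1 hX
  rw [expect_sum]
  refine Finset.sum_nonneg fun i _ => ?_
  rw [expect_vecMulVec]
  exact hρ.re_dotProduct_nonneg (v i)

/-- Centring an observable subtracts the squared mean from its second moment. -/
lemma expect_centred_sq [DecidableEq n] {ρ : Matrix n n ℂ} (h1 : expect ρ 1 = 1)
    (X : Matrix n n ℂ) :
    expect ρ ((X - (expect ρ X : ℂ) • 1) * (X - (expect ρ X : ℂ) • 1)) =
      expect ρ (X * X) - expect ρ X ^ 2 := by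
  have : (X - (expect ρ X : ℂ) • 1) * (X - (expect ρ X : ℂ) • 1) =
      X * X - ((2 * expect ρ X : ℝ) : ℂ) • X +
        ((expect ρ X ^ 2 : ℝ) : ℂ) • (1 : Matrix n n ℂ) := by
    simp only [sub_mul, mul_sub, smul_mul_assoc, mul_smul_comm, one_mul, mul_one]
    push_cast
    module
  rw [this, expect_add, expect_sub, expect_smul, expect_smul, h1]
  ring

omit [Fintype n] in
lemma isHermitian_centred [DecidableEq n] {X : Matrix n n ℂ} (hX : X.IsHermitian) (a : ℝ) :
    (X - (a : ℂ) • (1 : Matrix n n ℂ)).IsHermitian := by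
  refine hX.sub ?_
  rw [Matrix.IsHermitian, Matrix.conjTranspose_smul, Matrix.conjTranspose_one]
  simp

/-- The variance of `X` is the expectation of the square of the centred observable, hence
nonnegative. -/
lemma IsDensity.expect_sq_le [DecidableEq n] {ρ X : Matrix n n ℂ} (hρ : IsDensity ρ)
    (hX : X.IsHermitian) : expect ρ X ^ 2 ≤ expect ρ (X * X) := by
  have h := expect_conjTranspose_mul_nonneg hρ.posSemidef (X - (expect ρ X : ℂ) • 1)
  rw [(isHermitian_centred hX _).eq, expect_centred_sq hρ.expect_one] at h
  linarith

lemma hasDerivAt_expect {ρ : ℝ → Matrix n n ℂ} {D : Matrix n n ℂ} {b : ℝ}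
    (h : ∀ i j, HasDerivAt (fun b' => ρ b' i j) (D i j) b) (X : Matrix n n ℂ) :
    HasDerivAt (fun b' => expect (ρ b') X) (expect D X) b := by
  simp only [expect_eq_sum]
  refine HasDerivAt.fun_sum fun i _ => HasDerivAt.fun_sum fun j _ => ?_
  exact Complex.reCLM.hasFDerivAt.comp_hasDerivAt b ((h i j).mul_const (X j i))

/-- A sufficient condition for an upper bound on the quantum Fisher information: the symmetric
logarithmic derivative is one of the observables `X`. -/
lemma qfi_le {ρ : ℝ → Matrix n n ℂ} {b K : ℝ} (hρ : (ρ b).PosSemidef)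
    (hD : (derivMatrix ρ b).IsHermitian) (hK : 0 ≤ K)
    (h : ∀ X : Matrix n n ℂ, X.IsHermitian →
      expect (derivMatrix ρ b) X ^ 2 ≤ K * expect (ρ b) (X * X)) :
    qfi ρ b ≤ K := by
  classical
  have hH := hρ.1
  rw [qfi, dif_pos hH]
  have hs := hH.spectral_theorem
  set D := derivMatrix ρ b
  set V : Matrix n n ℂ := (hH.eigenvectorUnitary : Matrix n n ℂ)
  set p := hH.eigenvalues
  have hVV : Vᴴ * V = 1 := by
    rw [← Matrix.star_eq_conjTranspose]
    exact Unitary.coe_star_mul_self hH.eigenvectorUnitary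
  rw [Unitary.conjStarAlgAut_apply, Matrix.star_eq_conjTranspose] at hs
  change ρ b = V * Matrix.diagonal (Complex.ofReal ∘ p) * Vᴴ at hs
  set R := Vᴴ * D * V with hR
  have hRH : ∀ i j, R j i = star (R i j) := by
    have : R.IsHermitian := Matrix.isHermitian_conjTranspose_mul_mul V hD
    exact fun i j => (this.apply j i).symm
  -- `Y` is the symmetric logarithmic derivative in the eigenbasis of `ρ b`, set to zero where `pᵢ +
  -- pⱼ` vanishes. With `X = V Y Vᴴ`, both `expect D X` and `expect (ρ b) (X * X)` equal the quantum
  -- Fisher information `G`.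
  set Y : Matrix n n ℂ := Matrix.of fun i j =>
    if 0 < p i + p j then ((2 / (p i + p j) : ℝ) : ℂ) * R i j else 0 with hY
  have hYH : ∀ i j, Y j i = star (Y i j) := by
    intro i j
    simp only [hY, Matrix.of_apply, add_comm (p j) (p i)]
    split_ifs
    · rw [hRH i j, star_mul']
      simp
    · simp
  have hYherm : Y.IsHermitian := Matrix.IsHermitian.ext fun i j => (hYH j i).symm
  set X := V * Y * Vᴴ with hX
  have hXH : X.IsHermitian := Matrix.isHermitian_mul_mul_conjTranspose V hYherm
  set G := 2 * ∑ i, ∑ j, (if 0 < p i + p j then ‖R i j‖ ^ 2 / (p i + p j) else 0) with hG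
  have hDX : expect D X = G := by
    have e1 : (D * X).trace = (R * Y).trace := by
      rw [hX, hR, ← Matrix.mul_assoc, Matrix.trace_mul_comm]
      simp only [Matrix.mul_assoc]
    rw [expect, e1, ← expect, expect_eq_sum, hG, Finset.mul_sum]
    refine Finset.sum_congr rfl fun i _ => ?_
    rw [Finset.mul_sum]
    refine Finset.sum_congr rfl fun j _ => ?_
    rw [hYH i j]
    simp only [hY, Matrix.of_apply]
    split_ifs
    · rw [star_mul', mul_left_comm, RCLike.star_def, Complex.mul_conj,
        Complex.conj_ofReal, ← Complex.ofReal_mul, Complex.ofReal_re, Complex.normSq_eq_norm_sq]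
      ring
    · simp
  have hXX : expect (ρ b) (X * X) = G := by
    have e1 : (ρ b * (X * X)).trace =
        (Matrix.diagonal (Complex.ofReal ∘ p) * (Y * Y)).trace := by
      have e2 : X * X = V * (Y * Y) * Vᴴ := by
        calc X * X = V * Y * (Vᴴ * V) * Y * Vᴴ := by simp only [hX, Matrix.mul_assoc]
          _ = _ := by rw [hVV]; simp only [Matrix.mul_assoc, Matrix.one_mul]
      calc _ = (V * (Matrix.diagonal (Complex.ofReal ∘ p) * (Vᴴ * V) *
            (Y * Y) * Vᴴ)).trace := by
            rw [e2]
            conv_lhs => rw [hs]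
            simp only [Matrix.mul_assoc]
        _ = _ := by
            rw [hVV, Matrix.trace_mul_comm, Matrix.mul_one, Matrix.mul_assoc, hVV,
              Matrix.mul_one]
    have e3 : expect (ρ b) (X * X) = ∑ i, ∑ j, p i * ‖Y i j‖ ^ 2 := by
      rw [expect, e1, Matrix.trace, Complex.re_sum]
      refine Finset.sum_congr rfl fun i _ => ?_
      rw [Matrix.diag_apply, Matrix.diagonal_mul, Matrix.mul_apply, Function.comp_apply,
        Complex.re_ofReal_mul, Complex.re_sum, Finset.mul_sum]
      refine Finset.sum_congr rfl fun j _ => ?_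
      rw [hYH i j, RCLike.star_def, Complex.mul_conj, Complex.ofReal_re,
        Complex.normSq_eq_norm_sq]
    -- Since `|Y i j|` is symmetric, the weight `p i` may be replaced by the mean of `p i` and `p
    -- j`, which cancels one denominator of `Y`.
    have e4 : ∑ i, ∑ j, p i * ‖Y i j‖ ^ 2 = ∑ i, ∑ j, p j * ‖Y i j‖ ^ 2 := by
      rw [Finset.sum_comm]
      refine Finset.sum_congr rfl fun i _ => Finset.sum_congr rfl fun j _ => ?_
      rw [hYH i j, norm_star]
    have e5 : 2 * expect (ρ b) (X * X) = ∑ i, ∑ j, (p i + p j) * ‖Y i j‖ ^ 2 := by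
      rw [two_mul]
      nth_rewrite 2 [e3]
      rw [e4, e3, ← Finset.sum_add_distrib]
      refine Finset.sum_congr rfl fun i _ => ?_
      rw [← Finset.sum_add_distrib]
      exact Finset.sum_congr rfl fun j _ => by ring
    have e6 : ∑ i, ∑ j, (p i + p j) * ‖Y i j‖ ^ 2 = 2 * G := by
      rw [hG]
      simp only [Finset.mul_sum]
      refine Finset.sum_congr rfl fun i _ => Finset.sum_congr rfl fun j _ => ?_
      simp only [hY, Matrix.of_apply]
      split_ifs with hpos
      · rw [norm_mul, mul_pow, Complex.norm_real, Real.norm_eq_abs, sq_abs]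
        field_simp
      · simp
    linarith
  -- The hypothesis now reads `G² ≤ K G`.
  have hkey := h X hXH
  rw [hDX, hXX] at hkey
  have hG0 : 0 ≤ G := by
    refine mul_nonneg zero_le_two (Finset.sum_nonneg fun i _ => Finset.sum_nonneg fun j _ => ?_)
    split_ifs with hpos
    · positivity
    · exact le_rfl
  rcases hG0.eq_or_lt with h0 | h0
  · rw [← h0]; exact hK
  · exact le_of_mul_le_mul_right (by rw [← sq]; exact hkey) h0

end Expectation

end CollectiveDephasing

/-! ### Random density matrices with a score -/

/-- Cauchy-Schwarz inequality for square-integrable random variables. -/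
lemma MeasureTheory.sq_integral_mul_le {Ω : Type*} [MeasurableSpace Ω] {P : Measure Ω}
    {f g : Ω → ℝ} (hf : MemLp f 2 P) (hg : MemLp g 2 P) :
    (∫ ω, f ω * g ω ∂P) ^ 2 ≤ (∫ ω, f ω ^ 2 ∂P) * ∫ ω, g ω ^ 2 ∂P := by
  have hfg : Integrable (fun ω => f ω * g ω) P := hf.integrable_mul hg
  have h : ∀ s : ℝ, 0 ≤ (∫ ω, f ω ^ 2 ∂P) * (s * s) + (2 * ∫ ω, f ω * g ω ∂P) * s +
      ∫ ω, g ω ^ 2 ∂P := by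
    intro s
    have h0 : 0 ≤ ∫ ω, (s * f ω + g ω) ^ 2 ∂P := integral_nonneg fun ω => sq_nonneg _
    have e : ∀ ω, (s * f ω + g ω) ^ 2 = s * s * f ω ^ 2 + 2 * s * (f ω * g ω) + g ω ^ 2 :=
      fun ω => by ring
    simp only [e] at h0
    have hi1 : Integrable (fun ω => s * s * f ω ^ 2) P := hf.integrable_sq.const_mul _
    have hi2 : Integrable (fun ω => 2 * s * (f ω * g ω)) P := hfg.const_mul _
    rw [integral_add (hi1.fun_add hi2) hg.integrable_sq, integral_add hi1 hi2,
      integral_const_mul, integral_const_mul] at h0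
    linarith
  have := discrim_le_zero h
  rw [discrim] at this
  linarith

namespace CollectiveDephasing

section Average

variable {n : Type*} {Ω : Type*} [MeasurableSpace Ω]

/-- Entrywise expectation of a random matrix. -/
noncomputable def average (P : Measure Ω) (r : Ω → Matrix n n ℂ) : Matrix n n ℂ :=
  Matrix.of fun i j => ∫ ω, r ω i j ∂P

lemma isHermitian_average {P : Measure Ω} {r : Ω → Matrix n n ℂ}
    (h : ∀ ω, (r ω).IsHermitian) : (average P r).IsHermitian := by
  refine Matrix.IsHermitian.ext fun i j => ?_
  simp only [average, Matrix.of_apply]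
  rw [RCLike.star_def, ← integral_conj]
  exact integral_congr_ae (Eventually.of_forall fun ω => (h ω).apply i j)

variable [Fintype n]

lemma integrable_expect {P : Measure Ω} {r : Ω → Matrix n n ℂ}
    (h : ∀ i j, Integrable (fun ω => r ω i j) P) (X : Matrix n n ℂ) :
    Integrable (fun ω => expect (r ω) X) P := by
  simp only [expect_eq_sum]
  exact integrable_finsetSum _ fun i _ => integrable_finsetSum _ fun j _ =>
    ((h i j).mul_const (X j i)).re

lemma expect_average {P : Measure Ω} {r : Ω → Matrix n n ℂ}
    (h : ∀ i j, Integrable (fun ω => r ω i j) P) (X : Matrix n n ℂ) :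
    expect (average P r) X = ∫ ω, expect (r ω) X ∂P := by
  have hi : ∀ i j, Integrable (fun ω => (r ω i j * X j i).re) P :=
    fun i j => ((h i j).mul_const (X j i)).re
  simp only [expect_eq_sum]
  rw [integral_finsetSum _ fun i _ => integrable_finsetSum _ fun j _ => hi i j]
  refine Finset.sum_congr rfl fun i _ => ?_
  rw [integral_finsetSum _ fun j _ => hi i j]
  refine Finset.sum_congr rfl fun j _ => ?_
  have := integral_re ((h i j).mul_const (X j i))
  simp only [RCLike.re_to_complex] at this
  rw [this, integral_mul_const]
  rfl

lemma isDensity_average [DecidableEq n] {P : Measure Ω} [IsProbabilityMeasure P]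
    {r : Ω → Matrix n n ℂ} (h : ∀ i j, Integrable (fun ω => r ω i j) P)
    (hr : ∀ ω, IsDensity (r ω)) : IsDensity (average P r) where
  posSemidef := by
    have hH := isHermitian_average (P := P) fun ω => (hr ω).posSemidef.1
    refine Matrix.PosSemidef.of_dotProduct_mulVec_nonneg hH fun v => ?_
    rw [Complex.nonneg_iff]
    refine ⟨?_, (hH.im_star_dotProduct_mulVec_self v).symm⟩
    rw [← expect_vecMulVec, expect_average h]
    refine integral_nonneg fun ω => ?_
    rw [expect_vecMulVec]
    exact (hr ω).posSemidef.re_dotProduct_nonneg v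
  trace_eq_one := by
    have : (average P r).trace = ∫ ω, (r ω).trace ∂P := by
      simp only [Matrix.trace, Matrix.diag_apply, average, Matrix.of_apply]
      exact (integral_finsetSum _ fun i _ => h i i).symm
    simp [this, (hr _).trace_eq_one]

end Average

/-- A random density matrix `r` together with a centred real random variable `L` of second
moment at most `F`. -/
structure IsScoreModel {n Ω : Type*} [Fintype n] [MeasurableSpace Ω] (P : Measure Ω)
    (r : Ω → Matrix n n ℂ) (L : Ω → ℝ) (F : ℝ) : Prop where
  isDensity : ∀ ω, IsDensity (r ω)
  memLp : ∀ i j, MemLp (fun ω => r ω i j) 2 P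
  memLp_score : MemLp L 2 P
  integral_score : ∫ ω, L ω ∂P = 0
  integral_score_sq_le : ∫ ω, L ω ^ 2 ∂P ≤ F

/-- The matrix `𝔼[L r]`. -/
noncomputable def scoreAverage {n Ω : Type*} [MeasurableSpace Ω] (P : Measure Ω)
    (r : Ω → Matrix n n ℂ) (L : Ω → ℝ) : Matrix n n ℂ :=
  average P fun ω => (L ω : ℂ) • r ω

namespace IsScoreModel

variable {n Ω : Type*} [Fintype n] [DecidableEq n] [MeasurableSpace Ω] {P : Measure Ω}
  [IsProbabilityMeasure P] {r : Ω → Matrix n n ℂ} {L : Ω → ℝ} {F : ℝ}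

omit [DecidableEq n] in
lemma integrable (h : IsScoreModel P r L F) (i j : n) : Integrable (fun ω => r ω i j) P :=
  (h.memLp i j).integrable one_le_two

omit [DecidableEq n] [IsProbabilityMeasure P] in
lemma memLp_expect (h : IsScoreModel P r L F) (X : Matrix n n ℂ) :
    MemLp (fun ω => expect (r ω) X) 2 P := by
  simp only [expect_eq_sum]
  exact memLp_finsetSum _ fun i _ => memLp_finsetSum _ fun j _ =>
    ((h.memLp i j).mul_const (X j i)).re

omit [DecidableEq n] [IsProbabilityMeasure P] in
lemma expect_scoreAverage (h : IsScoreModel P r L F) (X : Matrix n n ℂ) :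
    expect (scoreAverage P r L) X = ∫ ω, L ω * expect (r ω) X ∂P := by
  rw [scoreAverage, expect_average]
  · simp only [smul_expect]
  · intro i j
    exact h.memLp_score.ofReal.integrable_mul (h.memLp i j)

omit [Fintype n] [DecidableEq n] [IsProbabilityMeasure P] in
lemma _root_.CollectiveDephasing.isHermitian_scoreAverage (hr : ∀ ω, (r ω).IsHermitian) :
    (scoreAverage P r L).IsHermitian :=
  isHermitian_average fun ω => by
    rw [Matrix.IsHermitian, Matrix.conjTranspose_smul, (hr ω).eq]
    simp

omit [IsProbabilityMeasure P] in
lemma expect_scoreAverage_one (h : IsScoreModel P r L F) :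
    expect (scoreAverage P r L) 1 = 0 := by
  rw [h.expect_scoreAverage]
  simp only [(h.isDensity _).expect_one, mul_one, h.integral_score]

omit [DecidableEq n] [IsProbabilityMeasure P] in
lemma nonneg (h : IsScoreModel P r L F) : 0 ≤ F :=
  (integral_nonneg fun ω => sq_nonneg (L ω)).trans h.integral_score_sq_le

omit [DecidableEq n] [IsProbabilityMeasure P] in
-- Cauchy-Schwarz over the noise, shared by the bounds for observables and for POVMs: `g` is a
-- conditional mean and `q` a conditional second moment dominating its square.
lemma sq_integral_score_mul_le (h : IsScoreModel P r L F) {g : Ω → ℝ} (hg : MemLp g 2 P)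
    {q : Ω → ℝ} (hq : Integrable q P) (hgq : ∀ ω, g ω ^ 2 ≤ q ω) :
    (∫ ω, L ω * g ω ∂P) ^ 2 ≤ F * ∫ ω, q ω ∂P :=
  (sq_integral_mul_le h.memLp_score hg).trans
    (mul_le_mul h.integral_score_sq_le (integral_mono hg.integrable_sq hq hgq)
      (integral_nonneg fun _ => sq_nonneg _) h.nonneg)

/-- The data-processing step: the information about the parameter in the averaged state is at most
that of the classical score, since in each realization the squared mean of `X` is at most its second
moment. -/
lemma sq_expect_scoreAverage_le (h : IsScoreModel P r L F) {X : Matrix n n ℂ}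
    (hX : X.IsHermitian) :
    expect (scoreAverage P r L) X ^ 2 ≤ F * expect (average P r) (X * X) := by
  rw [h.expect_scoreAverage, expect_average h.integrable]
  exact h.sq_integral_score_mul_le (h.memLp_expect X) (integrable_expect h.integrable _)
    fun ω => (h.isDensity ω).expect_sq_le hX

/-- The sensitivity of an observable is bounded by its variance. -/
lemma sq_expect_scoreAverage_le_variance (h : IsScoreModel P r L F) {X : Matrix n n ℂ}
    (hX : X.IsHermitian) :
    expect (scoreAverage P r L) X ^ 2 ≤
      F * (expect (average P r) (X * X) - expect (average P r) X ^ 2) := by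
  -- Centring leaves the left side unchanged, because the score has mean zero and so `scoreAverage`
  -- is traceless.
  have h1 := h.sq_expect_scoreAverage_le (isHermitian_centred hX (expect (average P r) X))
  rw [expect_centred_sq (isDensity_average h.integrable h.isDensity).expect_one, expect_sub,
    expect_smul, h.expect_scoreAverage_one] at h1
  simpa using h1

/-- The classical Fisher information of every measurement is bounded by `F`. -/
lemma sq_sum_expect_scoreAverage_le (h : IsScoreModel P r L F) {m : ℕ}
    {E : Fin m → Matrix n n ℂ} (hE : IsPOVM E) (a : Fin m → ℝ) :
    (∑ x, a x * expect (scoreAverage P r L) (E x)) ^ 2 ≤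
      F * ∑ x, a x ^ 2 * expect (average P r) (E x) := by
  have e1 : ∑ x, a x * expect (scoreAverage P r L) (E x) =
      ∫ ω, L ω * ∑ x, a x * expect (r ω) (E x) ∂P := by
    have : ∀ x, a x * expect (scoreAverage P r L) (E x) =
        ∫ ω, L ω * (a x * expect (r ω) (E x)) ∂P := by
      intro x
      rw [h.expect_scoreAverage, ← integral_const_mul]
      exact integral_congr_ae (Eventually.of_forall fun ω => by ring)
    simp only [this, Finset.mul_sum]
    rw [integral_finsetSum]
    exact fun x _ => h.memLp_score.integrable_mul ((h.memLp_expect (E x)).const_mul (a x))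
  have e2 : ∑ x, a x ^ 2 * expect (average P r) (E x) =
      ∫ ω, ∑ x, a x ^ 2 * expect (r ω) (E x) ∂P := by
    rw [integral_finsetSum _ fun x _ => (integrable_expect h.integrable (E x)).const_mul _]
    simp only [integral_const_mul, expect_average h.integrable]
  rw [e1, e2]
  refine h.sq_integral_score_mul_le
    (memLp_finsetSum _ fun x _ => (h.memLp_expect (E x)).const_mul (a x))
    (integrable_finsetSum _ fun x _ => (integrable_expect h.integrable (E x)).const_mul _)
    fun ω => ?_
  have hq : ∀ x, 0 ≤ expect (r ω) (E x) :=
    fun x => expect_nonneg (h.isDensity ω).posSemidef (hE.posSemidef x)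
  -- In a fixed realization the outcome probabilities sum to one, so the squared mean of `a` is at
  -- most the mean of `a²`.
  have hcs := Finset.sum_sq_le_sum_mul_sum_of_sq_le_mul Finset.univ
    (r := fun x => a x * expect (r ω) (E x)) (f := fun x => a x ^ 2 * expect (r ω) (E x))
    (g := fun x => expect (r ω) (E x)) (fun x _ => mul_nonneg (sq_nonneg _) (hq x))
    (fun x _ => hq x) (fun x _ => le_of_eq (by ring))
  rwa [expect_sum_povm hE, (h.isDensity ω).expect_one, mul_one] at hcs

end IsScoreModel

/-! ### Classical Cramér-Rao inequality for independent shots -/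

section ClassicalCramerRao

/-- Expectation of a product of one-shot functions under independent shots. -/
lemma sum_prod_mul_prod {ι : Type*} [Fintype ι] [DecidableEq ι] {α : Type*} [Fintype α]
    (p : α → ℝ) (g : ι → α → ℝ) :
    ∑ x : ι → α, (∏ s, p (x s)) * ∏ s, g s (x s) = ∏ s, ∑ y, p y * g s y := by
  rw [Finset.prod_univ_sum, Fintype.piFinset_univ]
  simp only [Finset.prod_mul_distrib]

/-- Variance of a sum of centred one-shot functions under independent shots. -/
lemma sum_prod_mul_sq_sum {ι : Type*} [Fintype ι] [DecidableEq ι] {α : Type*} [Fintype α]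
    {p ℓ : α → ℝ} (h1 : ∑ y, p y = 1) (h0 : ∑ y, p y * ℓ y = 0) :
    ∑ x : ι → α, (∏ s, p (x s)) * (∑ s, ℓ (x s)) ^ 2 =
      Fintype.card ι * ∑ y, p y * ℓ y ^ 2 := by
  have hpair : ∀ s s' : ι, ∑ x : ι → α, (∏ u, p (x u)) * (ℓ (x s) * ℓ (x s')) =
      if s = s' then ∑ y, p y * ℓ y ^ 2 else 0 := by
    intro s s'
    -- Written as a product over all shots, the expectation factorizes; for `s ≠ s'` the factor at
    -- `s` is the mean of `ℓ`, which is zero.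
    have e : ∀ x : ι → α, ℓ (x s) * ℓ (x s') =
        ∏ u, (if u = s then ℓ (x u) else 1) * (if u = s' then ℓ (x u) else 1) := by
      intro x
      rw [Finset.prod_mul_distrib, Finset.prod_ite_eq' Finset.univ s fun u => ℓ (x u),
        Finset.prod_ite_eq' Finset.univ s' fun u => ℓ (x u)]
      simp
    simp only [e]
    rw [sum_prod_mul_prod p fun u y => (if u = s then ℓ y else 1) * (if u = s' then ℓ y else 1)]
    split_ifs with h
    · subst h
      rw [Finset.prod_eq_single s]
      · simp [sq]
      · intro u _ hu
        simp [hu, h1]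
      · simp
    · refine Finset.prod_eq_zero (Finset.mem_univ s) ?_
      simpa [h] using h0
  have e : ∀ x : ι → α, (∏ u, p (x u)) * (∑ s, ℓ (x s)) ^ 2 =
      ∑ s, ∑ s', (∏ u, p (x u)) * (ℓ (x s) * ℓ (x s')) := by
    intro x
    rw [sq, Finset.sum_mul_sum, Finset.mul_sum]
    simp only [Finset.mul_sum]
  simp only [e]
  rw [Finset.sum_comm]
  have e' : ∀ s : ι, ∑ x : ι → α, ∑ s', (∏ u, p (x u)) * (ℓ (x s) * ℓ (x s')) =
      ∑ y, p y * ℓ y ^ 2 := by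
    intro s
    rw [Finset.sum_comm]
    simp only [hpair, Finset.sum_ite_eq, Finset.mem_univ, if_true]
  simp only [e', Finset.sum_const, Finset.card_univ, nsmul_eq_mul]

/-- Cramér-Rao inequality for independent repetitions of a finite experiment: `p` are the outcome
probabilities, `d` their derivatives, and `F` bounds the one-shot Fisher information. -/
lemma one_le_mul_variance {ι : Type*} [Fintype ι] [DecidableEq ι] {α : Type*} [Fintype α]
    [DecidableEq α] {p d : α → ℝ} {F b : ℝ} {est : (ι → α) → ℝ} (hp : ∀ x, 0 ≤ p x)
    (h1 : ∑ x, p x = 1) (h0 : ∑ x, d x = 0)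
    (hF : ∀ a : α → ℝ, (∑ x, a x * d x) ^ 2 ≤ F * ∑ x, a x ^ 2 * p x)
    (hest : ∑ x : ι → α, (∑ s, (∏ u ∈ Finset.univ.erase s, p (x u)) * d (x s)) * est x = 1) :
    1 ≤ Fintype.card ι * F * ∑ x : ι → α, (∏ s, p (x s)) * (est x - b) ^ 2 := by
  -- Testing `hF` on the indicator of `x` gives `(d x)² ≤ F p x`. Hence `d` vanishes wherever `p`
  -- does, and `ℓ = d / p`, with `0 / 0 = 0`, satisfies `p ℓ = d` everywhere.
  have hd : ∀ x, p x = 0 → d x = 0 := by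
    intro x hx
    have h := hF (Pi.single x 1)
    simp only [Pi.single_apply, ite_mul, one_mul, zero_mul, Finset.sum_ite_eq', Finset.mem_univ,
      if_true, ite_pow, one_pow, ne_eq, OfNat.ofNat_ne_zero, not_false_eq_true, zero_pow, hx,
      mul_zero] at h
    exact pow_eq_zero_iff two_ne_zero |>.1 (le_antisymm h (sq_nonneg _))
  set ℓ : α → ℝ := fun x => d x / p x with hℓ
  have hpl : ∀ x, p x * ℓ x = d x := by
    intro x
    by_cases hx : p x = 0
    · rw [hx, zero_mul, hd x hx]
    · rw [hℓ]
      field_simp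
  have hl0 : ∑ x, p x * ℓ x = 0 := by simpa only [hpl] using h0
  set I := ∑ x, p x * ℓ x ^ 2 with hI
  have hI0 : 0 ≤ I := Finset.sum_nonneg fun x _ => mul_nonneg (hp x) (sq_nonneg _)
  -- Testing `hF` on the score `ℓ` itself turns both sums into the Fisher information `I`.
  have hIF : I * I ≤ F * I := by
    have h := hF ℓ
    have e1 : ∑ x, ℓ x * d x = I :=
      Finset.sum_congr rfl fun x _ => by rw [← hpl x]; ring
    have e2 : ∑ x, ℓ x ^ 2 * p x = I := Finset.sum_congr rfl fun x _ => mul_comm _ _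
    rwa [e1, e2, sq] at h
  set w : (ι → α) → ℝ := fun x => ∏ s, p (x s) with hw
  have hw0 : ∀ x, 0 ≤ w x := fun x => Finset.prod_nonneg fun s _ => hp _
  have hder : ∀ x : ι → α, ∑ s, (∏ u ∈ Finset.univ.erase s, p (x u)) * d (x s) =
      w x * ∑ s, ℓ (x s) := by
    intro x
    rw [Finset.mul_sum]
    refine Finset.sum_congr rfl fun s _ => ?_
    rw [← hpl, ← mul_assoc, Finset.prod_erase_mul _ _ (Finset.mem_univ s)]
  have hscore : ∑ x, w x * ∑ s, ℓ (x s) = 0 := by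
    simp only [Finset.mul_sum]
    rw [Finset.sum_comm]
    refine Finset.sum_eq_zero fun s _ => ?_
    have := sum_prod_mul_prod (ι := ι) p fun u y => if u = s then ℓ y else 1
    simp only [Finset.prod_ite_eq', Finset.mem_univ, if_true] at this
    rw [this]
    exact Finset.prod_eq_zero (Finset.mem_univ s) (by simpa using hl0)
  have hone : ∑ x, w x * ((∑ s, ℓ (x s)) * (est x - b)) = 1 := by
    simp only [hder] at hest
    calc _ = ∑ x, w x * (∑ s, ℓ (x s)) * est x - (∑ x, w x * ∑ s, ℓ (x s)) * b := by
          rw [Finset.sum_mul, ← Finset.sum_sub_distrib]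
          exact Finset.sum_congr rfl fun x _ => by ring
      _ = 1 := by rw [hest, hscore]; ring
  have hcs := Finset.sum_sq_le_sum_mul_sum_of_sq_le_mul Finset.univ
    (r := fun x => w x * ((∑ s, ℓ (x s)) * (est x - b)))
    (f := fun x => w x * (∑ s, ℓ (x s)) ^ 2) (g := fun x => w x * (est x - b) ^ 2)
    (fun x _ => mul_nonneg (hw0 x) (sq_nonneg _)) (fun x _ => mul_nonneg (hw0 x) (sq_nonneg _))
    (fun x _ => le_of_eq (by ring))
  rw [hone, one_pow, sum_prod_mul_sq_sum h1 hl0, ← hI] at hcs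
  have hV : 0 ≤ ∑ x, w x * (est x - b) ^ 2 :=
    Finset.sum_nonneg fun x _ => mul_nonneg (hw0 x) (sq_nonneg _)
  -- Cancelling `I` needs `I ≠ 0`; if `I = 0`, Cauchy-Schwarz in `hcs` would read `1 ≤ 0`.
  have hle : I ≤ F := by
    rcases hI0.eq_or_lt with h | h
    · rw [← h] at hcs
      norm_num at hcs
    · exact le_of_mul_le_mul_right hIF h
  exact hcs.trans (mul_le_mul_of_nonneg_right
    (mul_le_mul_of_nonneg_left hle (Nat.cast_nonneg _)) hV)

end ClassicalCramerRao

/-! ### Bounds for the controlled output state -/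

section OutputState

variable {Ω : Type*} [MeasurableSpace Ω] {P : Measure Ω} {c : ℝ}
  {ξ : Lp ℝ 2 (volume : Measure ℝ) → Ω → ℝ} {N Q : ℕ} {t : ℝ} (S : PulseSequence N Q t)
  {ρ₀ : Op N}

lemma PulseSequence.isPhaseNoise (hξ : IsWhiteNoise ξ c P) :
    IsPhaseNoise (fun j : Fin (Q + 1) => phase ξ (S.time j.castSucc) (S.time j.succ)) c
      (fun j => S.time j.succ - S.time j.castSucc) P :=
  hξ.isPhaseNoise S.time_strictMono.monotone

lemma PulseSequence.sum_durations :
    ∑ j : Fin (Q + 1), (S.time j.succ - S.time j.castSucc) = t := by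
  have h : ∑ j : Fin (Q + 1), (S.time j.succ - S.time j.castSucc) =
      S.time (Fin.last (Q + 1)) - S.time 0 := by
    have h1 := Fin.sum_univ_succ S.time
    have h2 := Fin.sum_univ_castSucc S.time
    rw [Finset.sum_sub_distrib]
    linarith
  rw [h, S.time_last, S.time_zero, sub_zero]

/-- The score with respect to `b` of the segment phases. -/
noncomputable def PulseSequence.score (ξ : Lp ℝ 2 (volume : Measure ℝ) → Ω → ℝ) (c : ℝ) :
    Ω → ℝ :=
  IsPhaseNoise.score (fun j : Fin (Q + 1) => phase ξ (S.time j.castSucc) (S.time j.succ)) c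

/-- Output state of a single noise realization. -/
noncomputable def PulseSequence.realizedState (ξ : Lp ℝ 2 (volume : Measure ℝ) → Ω → ℝ)
    (ρ₀ : Op N) (b : ℝ) (ω : Ω) : Op N :=
  conditionalState S.angle S.op ρ₀ (segmentPhase S ξ b ω)

/-- The constant `t / c` arises because the segment durations sum to `t` however the pulses divide
the interval. Boundedness of trigonometric polynomials makes the entries square-integrable. -/
lemma isScoreModel_realizedState [IsProbabilityMeasure P] (hξ : IsWhiteNoise ξ c P)
    (hc : c ≠ 0) (hρ₀ : IsDensity ρ₀) (b : ℝ) :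
    IsScoreModel P (S.realizedState ξ ρ₀ b) (S.score ξ c) (t / c) where
  isDensity _ := isDensity_conditionalState _ S.op_isHermitian hρ₀ _
  memLp i j := by
    have hf := isTrigPoly_conditionalState S.angle S.op ρ₀ i j
    obtain ⟨C, hC⟩ := exists_norm_le_of_mem_trigPoly hf
    exact MemLp.of_bound ((S.isPhaseNoise hξ).integrable_shift hf b).1 C
      (Eventually.of_forall fun ω => hC _)
  memLp_score := (S.isPhaseNoise hξ).memLp_score
  integral_score := (S.isPhaseNoise hξ).integral_score
  integral_score_sq_le := by
    rw [PulseSequence.score, (S.isPhaseNoise hξ).integral_score_sq hc, S.sum_durations]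

lemma outputState_eq_average (b : ℝ) :
    outputState P ξ S ρ₀ b = average P (S.realizedState ξ ρ₀ b) := rfl

lemma hasDerivAt_outputState (hξ : IsWhiteNoise ξ c P) (hc : c ≠ 0) (b : ℝ)
    (i j : Fin N → Fin 2) :
    HasDerivAt (fun b' => outputState P ξ S ρ₀ b' i j)
      (scoreAverage P (S.realizedState ξ ρ₀ b) (S.score ξ c) i j) b :=
  (S.isPhaseNoise hξ).hasDerivAt_integral_shift hc
    (isTrigPoly_conditionalState S.angle S.op ρ₀ i j) b

lemma derivMatrix_outputState (hξ : IsWhiteNoise ξ c P) (hc : c ≠ 0) (b : ℝ) :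
    derivMatrix (outputState P ξ S ρ₀) b =
      scoreAverage P (S.realizedState ξ ρ₀ b) (S.score ξ c) := by
  ext i j
  exact (hasDerivAt_outputState S hξ hc b i j).deriv

variable [IsProbabilityMeasure P]

lemma isDensity_outputState (hξ : IsWhiteNoise ξ c P) (hc : c ≠ 0) (hρ₀ : IsDensity ρ₀) (b : ℝ) :
    IsDensity (outputState P ξ S ρ₀ b) :=
  have h := isScoreModel_realizedState S hξ hc hρ₀ b
  isDensity_average h.integrable h.isDensity

lemma qfi_outputState_le (hξ : IsWhiteNoise ξ c P) (hc : c ≠ 0) (hρ₀ : IsDensity ρ₀) (b : ℝ) :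
    qfi (outputState P ξ S ρ₀) b ≤ t / c := by
  have h := isScoreModel_realizedState S hξ hc hρ₀ b
  have hD := derivMatrix_outputState S (ρ₀ := ρ₀) hξ hc b
  refine qfi_le (isDensity_outputState S hξ hc hρ₀ b).posSemidef ?_ h.nonneg fun X hX => ?_
  · rw [hD]
    exact isHermitian_scoreAverage fun ω => (h.isDensity ω).posSemidef.1
  · rw [hD]
    exact h.sq_expect_scoreAverage_le hX

lemma le_momentError_outputState (hξ : IsWhiteNoise ξ c P) (hc : 0 < c) (hρ₀ : IsDensity ρ₀)
    {T : ℝ} (hT : 0 < T) (b : ℝ) {O : Op N} (hO : O.IsHermitian)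
    (hd : deriv (fun b' => expect (outputState P ξ S ρ₀ b') O) b ≠ 0) :
    c / T ≤ momentError T t (outputState P ξ S ρ₀) O b := by
  have h := (isScoreModel_realizedState S hξ hc.ne' hρ₀ b).sq_expect_scoreAverage_le_variance hO
  rw [← (hasDerivAt_expect (hasDerivAt_outputState S (ρ₀ := ρ₀) hξ hc.ne' b) O).deriv,
    ← outputState_eq_average] at h
  rw [momentError, div_le_div_iff₀ hT (mul_pos hT (sq_pos_of_ne_zero hd))]
  have h2 := mul_le_mul_of_nonneg_left h (mul_pos hc hT).le
  calc _ = c * T * deriv (fun b' => expect (outputState P ξ S ρ₀ b') O) b ^ 2 := by ring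
    _ ≤ _ := h2
    _ = _ := by field_simp

lemma one_le_mul_dataExpect_outputState (hξ : IsWhiteNoise ξ c P) (hc : c ≠ 0)
    (hρ₀ : IsDensity ρ₀) (b : ℝ) {ν m : ℕ} {E : Fin m → Op N} {est : (Fin ν → Fin m) → ℝ}
    (hE : IsPOVM E)
    (hest : ∀ᶠ b' in 𝓝 b, dataExpect (outputState P ξ S ρ₀ b') E est = b') :
    1 ≤ ν * (t / c) * dataExpect (outputState P ξ S ρ₀ b) E fun x => (est x - b) ^ 2 := by
  have h := isScoreModel_realizedState S hξ hc hρ₀ b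
  have hρ := isDensity_outputState S hξ hc hρ₀ b
  set D := scoreAverage P (S.realizedState ξ ρ₀ b) (S.score ξ c)
  have hp' : ∀ x, HasDerivAt (fun b' => expect (outputState P ξ S ρ₀ b') (E x))
      (expect D (E x)) b :=
    fun x => hasDerivAt_expect (hasDerivAt_outputState S hξ hc b) (E x)
  have hder : HasDerivAt (fun b' => dataExpect (outputState P ξ S ρ₀ b') E est)
      (∑ x : Fin ν → Fin m, (∑ s, (∏ u ∈ Finset.univ.erase s,
        expect (outputState P ξ S ρ₀ b) (E (x u))) * expect D (E (x s))) * est x) b :=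
    HasDerivAt.fun_sum fun x _ =>
      (HasDerivAt.fun_finsetProd fun s _ => hp' (x s)).mul_const (est x)
  -- Local unbiasedness makes the mean of the estimator coincide with the identity near `b`, so its
  -- derivative is `1`.
  have hone := hder.unique ((hasDerivAt_id b).congr_of_eventuallyEq hest)
  have := one_le_mul_variance (b := b) (F := t / c)
    (fun x => expect_nonneg hρ.posSemidef (hE.posSemidef x))
    ((expect_sum_povm hE _).trans hρ.expect_one)
    ((expect_sum_povm hE _).trans h.expect_scoreAverage_one)
    (fun a => h.sq_sum_expect_scoreAverage_le hE a) hone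
  rwa [Fintype.card_fin] at this

end OutputState

end CollectiveDephasing

theorem corollary1
    {Ω : Type*} [MeasurableSpace Ω] (P : Measure Ω) [IsProbabilityMeasure P]
    (χ₀ ωc : ℝ) (hχ₀ : 0 < χ₀) (hωc : 0 < ωc)
    (ξ : Lp ℝ 2 (volume : Measure ℝ) → Ω → ℝ) (hξ : IsWhiteNoise ξ (χ₀ * ωc) P)
    (N Q : ℕ) (t T : ℝ) (ht : 0 < t) (hT : 0 < T)
    (S : PulseSequence N Q t) (ρ₀ : Op N) (hρ₀ : IsDensity ρ₀) :
    -- the output states are density matrices that depend differentiably on the parameter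
    (∀ b, IsDensity (outputState P ξ S ρ₀ b)) ∧
    (∀ i j, Differentiable ℝ fun b => outputState P ξ S ρ₀ b i j) ∧
    -- total quantum Fisher information and quantum Cramér-Rao bound
    (∀ b, totalQFI T t (outputState P ξ S ρ₀) b ≤ T / (χ₀ * ωc)) ∧
    (∀ b, ENNReal.ofReal (χ₀ * ωc / T) ≤ qcrb T t (outputState P ξ S ρ₀) b) ∧
    -- precision of the method of moments, for every observable
    (∀ (b : ℝ) (O : Op N), O.IsHermitian →
      deriv (fun b' => expect (outputState P ξ S ρ₀ b') O) b ≠ 0 →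
      χ₀ * ωc / T ≤ momentError T t (outputState P ξ S ρ₀) O b) ∧
    -- variance of every locally unbiased estimator, for every measurement
    (∀ (b : ℝ) (ν m : ℕ) (E : Fin m → Op N) (est : (Fin ν → Fin m) → ℝ),
      (ν : ℝ) * t = T → IsPOVM E →
      (∀ᶠ b' in 𝓝 b, dataExpect (outputState P ξ S ρ₀ b') E est = b') →
      χ₀ * ωc / T ≤ dataExpect (outputState P ξ S ρ₀ b) E fun x => (est x - b) ^ 2) := by
  have hc : 0 < χ₀ * ωc := mul_pos hχ₀ hωc
  have hqfi : ∀ b, totalQFI T t (outputState P ξ S ρ₀) b ≤ T / (χ₀ * ωc) := by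
    intro b
    calc _ ≤ T / t * (t / (χ₀ * ωc)) :=
          mul_le_mul_of_nonneg_left (qfi_outputState_le S hξ hc.ne' hρ₀ b) (div_pos hT ht).le
      _ = _ := by field_simp
  refine ⟨isDensity_outputState S hξ hc.ne' hρ₀,
    fun i j b => (hasDerivAt_outputState S hξ hc.ne' b i j).differentiableAt, hqfi,
    fun b => ?_, fun b O hO hd => le_momentError_outputState S hξ hc hρ₀ hT b hO hd,
    fun b ν m E est hν hE hest => ?_⟩
  · rw [qcrb, ENNReal.le_inv_iff_le_inv, ← ENNReal.ofReal_inv_of_pos (div_pos hc hT), inv_div]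
    exact ENNReal.ofReal_le_ofReal (hqfi b)
  · have h := one_le_mul_dataExpect_outputState S hξ hc.ne' hρ₀ b hE hest
    rw [← mul_div_assoc, hν] at h
    calc _ = χ₀ * ωc / T * 1 := (mul_one _).symm
      _ ≤ χ₀ * ωc / T * _ := mul_le_mul_of_nonneg_left h (div_pos hc hT).le
      _ = _ := by field_simp
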